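/- For integers $n,r\ge 1$ let $w_{n,r}\in\{0,1\}^n$ be the prefix of length $n$ of the infinite word $0^r1^r0^r1^r\cdots$; thus $w_{n,r}=(0^r1^r)^{n/2r}$ whenever $2r\mid n$. For $0<\varepsilon<1$ and $n\ge 1$ let $$C_{n,\varepsilon}=\Big\{\,w_{n,r}\;:\; r=\Big\lfloor\Big(\frac1{\varepsilon^4}\Big)^k\Big\rfloor,\ k\in\mathbb{Z}_{\ge 0},\ k<\log_{1/\varepsilon^4}n\Big\}$$ be the Bukh--Ma code (the rounding has no effect when $1/\varepsilon^4$ is an integer). Theorem. There is an absolute constant $A>0$ such that for every $\varepsilon\in(0,1)$ there is an $n_0=n_0(\varepsilon)$ such that for all $n\ge n_0$ and all real $\delta,\gamma\ge 0$ with $\gamma+2\delta<1-\varepsilon$, the code $C_{n,\varepsilon}$ is list-decodable from any $\delta n$ deletions and $\gamma n$ insertions with list size $O(1/\varepsilon^3)$; that is, for every binary word $v$ of any length, there are at most $A/\varepsilon^3$ codewords $c\in C_{n,\varepsilon}$ such that $v$ can be obtained from $c$ by at most $\delta n$ deletions and at most $\gamma n$ insertions of symbols. (For $\varepsilon\ge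 1$ no such $\delta,\gamma$ exist, so the restriction to $\varepsilon<1$ loses nothing.) -/

import Mathlib

/-- `Edits d i c v`: the word `v` can be obtained from the word `c` by a sequence of edits, in any
order and at any positions, which consists of exactly `d` deletions of one symbol and exactly `i`
insertions of one symbol. -/
inductive Edits {α : Type} : ℕ → ℕ → List α → List α → Prop
  | refl (c : List α) : Edits 0 0 c c
  | delete {d i : ℕ} {c x y : List α} (a : α) (h : Edits d i c (x ++ a :: y)) :
      Edits (d + 1) i c (x ++ y)
  | insert {d i : ℕ} {c x y : List α} (a : α) (h : Edits d i c (x ++ y)) :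
      Edits d (i + 1) c (x ++ a :: y)

/-- The code `C` is list-decodable with list size `L` from any `D` deletions and `I` insertions:
for every received word `v` there are at most `L` codewords from which `v` can result by at most
`D` deletions and at most `I` insertions. -/
def IsListDecodable {α : Type} (C : Set (List α)) (D I : ℝ) (L : ℕ) : Prop :=
  ∀ v : List α,
    {c ∈ C | ∃ d i : ℕ, (d : ℝ) ≤ D ∧ (i : ℝ) ≤ I ∧ Edits d i c v}.encard ≤ L

/-- The word `(0^r 1^r)^m`, with `false` for `0` and `true` for `1`. -/
def blockPower (r m : ℕ) : List Bool :=
  (List.replicate m (List.replicate r false ++ List.replicate r true)).flatten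

/-- The prefix of length `n` of the infinite word `0^r 1^r 0^r 1^r ...` (for `1 ≤ r`).
It is `(0^r 1^r)^(n / 2r)` when `2r` divides `n`, see `bukhMaWord_eq_blockPower`. -/
def bukhMaWord (n r : ℕ) : List Bool :=
  (blockPower r n).take n

theorem length_blockPower (r m : ℕ) : (blockPower r m).length = m * (2 * r) := by
  simp [blockPower, two_mul]

theorem length_bukhMaWord (n r : ℕ) (hr : 1 ≤ r) : (bukhMaWord n r).length = n := by
  rw [bukhMaWord, List.length_take, length_blockPower]
  exact min_eq_left (by nlinarith)

theorem bukhMaWord_eq_blockPower (n r : ℕ) (hr : 1 ≤ r) (h : 2 * r ∣ n) :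
    bukhMaWord n r = blockPower r (n / (2 * r)) := by
  obtain ⟨m, rfl⟩ := h
  have h2 : 0 < 2 * r := by omega
  rw [Nat.mul_div_cancel_left m h2]
  have hm : m ≤ 2 * r * m := Nat.le_mul_of_pos_left m h2
  obtain ⟨j, hj⟩ := Nat.exists_eq_add_of_le hm
  have hs : blockPower r (2 * r * m) = blockPower r m ++ blockPower r j := by
    rw [hj]
    unfold blockPower
    rw [List.replicate_add m j, List.flatten_append]
  rw [bukhMaWord, hs]
  exact List.take_left' (by rw [length_blockPower, mul_comm])

/-- The Bukh-Ma code `C_{n,ε}` of block length `n`: its codewords oscillate with the half-periods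
`r = (1/ε^4)^k` for the natural numbers `k < log_{1/ε^4} n`. A non-integral `r` is rounded down
(this changes nothing when `r` is an integer), and the last repetition of `0^r 1^r` is cut off
at length `n` when `2r` does not divide `n`. -/
def bukhMaCode (n : ℕ) (ε : ℝ) : Set (List Bool) :=
  {c | ∃ k : ℕ, (k : ℝ) < Real.logb (1 / ε ^ 4) n ∧ c = bukhMaWord n ⌊(1 / ε ^ 4) ^ k⌋₊}

/-! Read a received word `v` as a sequence of signs, and let the energy at scale `B` be the square
sum of its means over blocks of length `B`. Along dyadic scales the energy decreases, and by
Pythagoras (`blockEnergy_sub`) its drop is the squared distance between the two averaged sequences.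

Suppose the word of half-period `r` is close to `v`. Its runs cut `v` into pieces. If the block
means at scale about `ε r` barely differed from those at scale about `r / ε`, consecutive pieces
would see the same bias. That bias helps the runs of one symbol exactly as much as it hurts those of
the other, so too few symbols could be matched (`Edits.le_sum_abs_blockMean_sub`). Hence the energy
drops by a multiple of `ε ^ 2 * n` between these scales (`Edits.blockEnergy_drop`). The whole energy
is at most `2 * n`, and well separated half-periods use disjoint ranges of scales, so `O(1 / ε ^ 2)`
of them are close to `v` (`card_le_of_separated`).

Away from `ε = 1`, the exponents split into boundedly many separated classes. Near `ε = 1` the ratio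
`1 / ε ^ 4` tends to 1 and this fails. There any two codewords close to `v` are close to each other,
so their half-periods nearly agree and at most seven values remain (`card_image_le_of_ge`). -/

namespace Edits

theorem trans {α : Type} {d₁ i₁ d₂ i₂ : ℕ} {a b c : List α} (h₁ : Edits d₁ i₁ a b)
    (h₂ : Edits d₂ i₂ b c) : Edits (d₁ + d₂) (i₁ + i₂) a c := by
  induction h₂ with
  | refl => exact h₁
  | delete s _ ih => exact (ih h₁).delete s
  | insert s _ ih => exact (ih h₁).insert s

theorem symm {α : Type} {d i : ℕ} {a b : List α} (h : Edits d i a b) : Edits i d b a := by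
  induction h with
  | refl => exact .refl _
  | delete s _ ih => simpa [add_comm] using (Edits.insert s (.refl _)).trans ih
  | insert s _ ih => simpa [add_comm] using (Edits.delete s (.refl _)).trans ih

theorem length_add {α : Type} {d i : ℕ} {a b : List α} (h : Edits d i a b) :
    b.length + d = a.length + i := by
  induction h with
  | refl => rfl
  | delete s _ ih => simp at ih ⊢; omega
  | insert s _ ih => simp at ih ⊢; omega

theorem exists_common_sublist {α : Type} {d i : ℕ} {a b : List α} (h : Edits d i a b) :
    ∃ u : List α, u.Sublist a ∧ u.Sublist b ∧ a.length ≤ u.length + d := by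
  induction h with
  | refl => exact ⟨_, .refl _, .refl _, le_rfl⟩
  | delete s _ ih =>
    obtain ⟨u, hua, hub, hl⟩ := ih
    obtain ⟨u₁, u₂, rfl, h₁, h₂⟩ := List.sublist_append_iff.1 hub
    rcases List.sublist_cons_iff.1 h₂ with h₂ | ⟨u₃, rfl, h₃⟩
    · exact ⟨_, hua, h₁.append h₂, by omega⟩
    · refine ⟨u₁ ++ u₃, ?_, h₁.append h₃, by simp at hl ⊢; omega⟩
      exact ((List.Sublist.refl u₁).append (List.sublist_cons_self s u₃)).trans hua
  | insert s _ ih =>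
    obtain ⟨u, hua, hub, hl⟩ := ih
    exact ⟨u, hua, hub.trans ((List.Sublist.refl _).append (List.sublist_cons_self s _)), by omega⟩

end Edits

/-! ### Run decomposition of the codewords. -/

/-- The word `0^(ℓ 0) 1^(ℓ 1) 0^(ℓ 2) ⋯` with `T` runs. -/
def runWord (ℓ : ℕ → ℕ) : ℕ → List Bool
  | 0 => []
  | T + 1 => runWord ℓ T ++ List.replicate (ℓ T) (decide (T % 2 = 1))

theorem length_runWord_const (r T : ℕ) : (runWord (fun _ => r) T).length = T * r := by
  induction T with
  | zero => simp [runWord]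
  | succ T ih => simp [runWord, ih]; ring

theorem runWord_congr {ℓ ℓ' : ℕ → ℕ} {T : ℕ} (h : ∀ t < T, ℓ t = ℓ' t) :
    runWord ℓ T = runWord ℓ' T := by
  induction T with
  | zero => rfl
  | succ T ih => simp [runWord, ih fun t ht => h t (by omega), h T (by omega)]

theorem blockPower_eq_runWord (r m : ℕ) : blockPower r m = runWord (fun _ => r) (2 * m) := by
  induction m with
  | zero => rfl
  | succ m ih =>
    have : blockPower r (m + 1) =
        blockPower r m ++ (List.replicate r false ++ List.replicate r true) := by
      simp [blockPower, List.replicate_succ']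
    rw [this, ih, show 2 * (m + 1) = 2 * m + 1 + 1 by ring, runWord, runWord]
    simp [Nat.add_mod]

theorem runWord_prefix (ℓ : ℕ → ℕ) (T k : ℕ) : runWord ℓ T <+: runWord ℓ (T + k) := by
  induction k with
  | zero => exact List.prefix_rfl
  | succ k ih => exact ih.trans (List.prefix_append _ _)

/-- The run lengths of `bukhMaWord n r`. -/
def runLength (n r t : ℕ) : ℕ := if t < n / r then r else n % r

theorem bukhMaWord_eq_runWord {n r : ℕ} (hn : 1 ≤ n) (hr : 1 ≤ r) :
    bukhMaWord n r = runWord (runLength n r) (n / r + 1) := by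
  have hle : n / r + 1 ≤ 2 * n := by have := Nat.div_le_self n r; omega
  obtain ⟨k, hk⟩ := Nat.exists_eq_add_of_le hle
  obtain ⟨z, hz⟩ := runWord_prefix (fun _ => r) (n / r + 1) k
  have hdm := Nat.div_add_mod n r
  have hmod := Nat.mod_lt n hr
  rw [bukhMaWord, blockPower_eq_runWord, hk, ← hz, List.take_append_of_le_length, runWord, runWord,
    List.take_append, List.take_of_length_le, length_runWord_const]
  · congr 1
    · exact runWord_congr fun t ht => by simp [runLength, ht]
    · rw [List.take_replicate]
      have : n - n / r * r = n % r := by rw [mul_comm]; omega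
      simp [this, runLength, hmod.le]
  · rw [length_runWord_const, mul_comm]; omega
  · rw [length_runWord_const]; nlinarith

/-! ### Sign sums and cutting the received word along the runs. -/

/-- The symbols of a binary word as signs (`1` for `0` and `-1` for `1`), and zero beyond its end. -/
def signAt (v : List Bool) (p : ℕ) : ℝ :=
  if v[p]? = some false then 1 else if v[p]? = some true then -1 else 0

theorem abs_signAt_le (v : List Bool) (p : ℕ) : |signAt v p| ≤ 1 := by
  unfold signAt; split_ifs <;> simp

/-- The number of zeros minus the number of ones among the first `s` symbols. -/
def signSum (v : List Bool) (s : ℕ) : ℝ := ∑ p ∈ Finset.range s, signAt v p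

theorem signSum_eq_count (v : List Bool) (s : ℕ) :
    signSum v s = (v.take s).count false - (v.take s).count true := by
  induction s with
  | zero => simp [signSum]
  | succ s ih =>
    rw [signSum, Finset.sum_range_succ, ← signSum, ih, List.take_add_one, List.count_append,
      List.count_append, signAt]
    rcases v[s]? with _ | b
    · simp
    · cases b <;> simp <;> ring

theorem two_mul_count_take (v : List Bool) {s : ℕ} (hs : s ≤ v.length) (t : ℕ) :
    2 * ((v.take s).count (decide (t % 2 = 1)) : ℝ) = s + (-1) ^ t * signSum v s := by
  have h : (v.take s).count true + (v.take s).count false = s := by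
    rw [List.count_true_add_count_false, List.length_take, min_eq_left hs]
  have h' : ((v.take s).count true : ℝ) + (v.take s).count false = s := by exact_mod_cast h
  rw [signSum_eq_count]
  rcases Nat.even_or_odd t with ht | ht
  · rw [ht.neg_one_pow, Nat.even_iff.1 ht]; simp; linarith
  · rw [ht.neg_one_pow, Nat.odd_iff.1 ht]; simp; linarith

/-- A common subsequence of a word with `T` runs and of a word `v` cuts `v` into `T` pieces. -/
theorem exists_cuts (v : List Bool) (ℓ : ℕ → ℕ) (T : ℕ) :
    ∀ (u : List Bool) (s : ℕ), s ≤ v.length → u.Sublist (runWord ℓ T) → u.Sublist (v.take s) →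
    ∃ (p M : ℕ → ℕ), p 0 = 0 ∧ u.length ≤ ∑ t ∈ Finset.range T, M t ∧ p T ≤ s ∧
      ∀ t < T, p t ≤ p (t + 1) ∧ M t ≤ ℓ t ∧
        2 * (M t : ℝ) ≤ ((p (t + 1) : ℝ) - p t) +
          (-1) ^ t * (signSum v (p (t + 1)) - signSum v (p t)) := by
  induction T with
  | zero =>
    intro u s hs hu _
    exact ⟨fun _ => 0, fun _ => 0, rfl, by simpa [runWord] using hu, by simp, by simp⟩
  | succ T ih =>
    intro u s hs hu hv
    obtain ⟨u₁, u₂, rfl, h₁, h₂⟩ := List.sublist_append_iff.1 hu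
    obtain ⟨v₁, v₂, hv12, hv₁, hv₂⟩ := List.append_sublist_iff.1 hv
    have hlen : v₁.length + v₂.length = s := by
      have := congrArg List.length hv12
      simp at this; omega
    have htake : v₁ = v.take v₁.length := by
      have := congrArg (List.take v₁.length) hv12
      rw [List.take_take, min_eq_left (by omega)] at this
      simpa using this.symm
    obtain ⟨p, M, hp0, hM, hpT, hst⟩ := ih u₁ v₁.length (by omega) h₁ (htake ▸ hv₁)
    -- The last piece runs from `p T` to `s`, so it also absorbs whatever lies between `p T` and the
    -- end of `v₁`; extra letters only weaken the bound on matches.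
    refine ⟨fun t => if t ≤ T then p t else s, fun t => if t < T then M t else u₂.length,
      by simpa using hp0, ?_, by simp, ?_⟩
    · rw [Finset.sum_range_succ, List.length_append]
      have : ∑ t ∈ Finset.range T, (if t < T then M t else u₂.length)
          = ∑ t ∈ Finset.range T, M t :=
        Finset.sum_congr rfl fun t ht => by simp [Finset.mem_range.1 ht]
      simp [this, hM]
    · intro t ht
      rcases Nat.lt_succ_iff_lt_or_eq.1 ht with ht | rfl
      · have h1 : t ≤ T := ht.le
        have h2 : t + 1 ≤ T := ht
        simpa [h1, h2, ht] using hst t ht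
      · have hrep : u₂ = List.replicate u₂.length (decide (t % 2 = 1)) :=
          List.eq_replicate_of_mem fun b hb => List.eq_of_mem_replicate (h₂.subset hb)
        have hcount : u₂.length ≤ v₂.count (decide (t % 2 = 1)) := by
          have := hv₂.count_le (decide (t % 2 = 1))
          rw [hrep] at this
          simpa using this
        have hc : (v.take s).count (decide (t % 2 = 1)) =
            (v.take v₁.length).count (decide (t % 2 = 1)) + v₂.count (decide (t % 2 = 1)) := by
          rw [hv12, List.count_append, ← htake]
        have hmono : (v.take (p t)).count (decide (t % 2 = 1)) ≤
            (v.take v₁.length).count (decide (t % 2 = 1)) :=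
          (List.take_sublist_take_left hpT).count_le _
        have hfin : (u₂.length : ℝ) + (v.take (p t)).count (decide (t % 2 = 1)) ≤
            (v.take s).count (decide (t % 2 = 1)) := by
          exact_mod_cast (by omega)
        have e1 := two_mul_count_take v hs t
        have e2 := two_mul_count_take v (s := p t) (by omega) t
        have hl : u₂.length ≤ ℓ t := by simpa using h₂.length_le
        simp only [le_refl, if_true, lt_irrefl, if_false, not_le.2 (Nat.lt_succ_self t)]
        exact ⟨by omega, hl, by linarith⟩

theorem Edits.exists_cuts {n r d i : ℕ} {v : List Bool} (hn : 1 ≤ n) (hr : 1 ≤ r)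
    (h : Edits d i (bukhMaWord n r) v) :
    ∃ (p M : ℕ → ℕ), p 0 = 0 ∧ n ≤ (∑ t ∈ Finset.range (n / r + 1), M t) + d ∧
      p (n / r + 1) ≤ v.length ∧
      ∀ t < n / r + 1, p t ≤ p (t + 1) ∧ M t ≤ runLength n r t ∧
        2 * (M t : ℝ) ≤ ((p (t + 1) : ℝ) - p t) +
          (-1) ^ t * (signSum v (p (t + 1)) - signSum v (p t)) := by
  obtain ⟨u, h₁, h₂, h₃⟩ := h.exists_common_sublist
  rw [length_bukhMaWord n r hr] at h₃
  rw [bukhMaWord_eq_runWord hn hr] at h₁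
  obtain ⟨p, M, hp, hM, hT, ht⟩ :=
    _root_.exists_cuts v (runLength n r) (n / r + 1) u v.length le_rfl h₁ (by simpa using h₂)
  exact ⟨p, M, hp, by omega, hT, ht⟩

/-! ### Distance between two codewords. -/

theorem signSum_runWord_mem (r T s : ℕ) :
    (((runWord (fun _ => r) T).take s).count false : ℤ) -
      ((runWord (fun _ => r) T).take s).count true ∈ Set.Icc (0 : ℤ) r := by
  have hfull : ∀ T, ((runWord (fun _ => r) T).count false : ℤ) -
      (runWord (fun _ => r) T).count true = if T % 2 = 1 then (r : ℤ) else 0 := by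
    intro T
    induction T with
    | zero => simp [runWord]
    | succ T ih =>
      simp only [runWord, List.count_append, Nat.cast_add]
      rcases Nat.mod_two_eq_zero_or_one T with h | h
      · have h' : (T + 1) % 2 = 1 := by omega
        simp [h, h', List.count_replicate] at ih ⊢; omega
      · have h' : (T + 1) % 2 = 0 := by omega
        simp [h, h', List.count_replicate] at ih ⊢; omega
  induction T with
  | zero => simp [runWord]
  | succ T ih =>
    rw [runWord, List.take_append]
    rcases le_total s (runWord (fun _ => r) T).length with hs | hs
    · simpa [Nat.sub_eq_zero_of_le hs] using ih
    · rw [List.take_of_length_le hs, List.take_replicate]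
      have := hfull T
      set k := min (s - (runWord (fun _ => r) T).length) r
      have hk : k ≤ r := min_le_right _ _
      simp only [List.count_append, Nat.cast_add, Set.mem_Icc]
      rcases Nat.mod_two_eq_zero_or_one T with h | h
      · simp [h, List.count_replicate] at this ⊢; omega
      · simp [h, List.count_replicate] at this ⊢; omega

theorem signSum_bukhMaWord_mem (n r s : ℕ) :
    0 ≤ signSum (bukhMaWord n r) s ∧ signSum (bukhMaWord n r) s ≤ r := by
  rw [signSum_eq_count, bukhMaWord, blockPower_eq_runWord, List.take_take]
  obtain ⟨h1, h2⟩ := signSum_runWord_mem r (2 * n) (min s n)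
  exact ⟨by exact_mod_cast h1, by exact_mod_cast h2⟩

/-- Words with different half-periods are far apart. -/
theorem Edits.le_two_mul_of_bukhMaWord {n r r' d i : ℕ} (hn : 1 ≤ n) (hr : 1 ≤ r) (hrr : r ≤ r')
    (h : Edits d i (bukhMaWord n r') (bukhMaWord n r)) :
    (n / r' : ℕ) * ((r' : ℝ) - r) ≤ 2 * d := by
  obtain ⟨p, M, hp0, hM, hpT, ht⟩ := h.exists_cuts hn (hr.trans hrr)
  rw [length_bukhMaWord n r hr] at hpT
  set q := n / r' with hq
  have hbound : ∀ t ∈ Finset.range (q + 1),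
      2 * (M t : ℝ) ≤ ((p (t + 1) : ℝ) - p t) + if t < q then (r : ℝ) else (n % r' : ℕ) := by
    intro t htm
    obtain ⟨h1, h2, h3⟩ := ht t (Finset.mem_range.1 htm)
    obtain ⟨a1, a2⟩ := signSum_bukhMaWord_mem n r (p t)
    obtain ⟨b1, b2⟩ := signSum_bukhMaWord_mem n r (p (t + 1))
    split_ifs with htq
    · rcases neg_one_pow_eq_or ℝ t with e | e <;> rw [e] at h3 <;> linarith
    -- The truncated last run is bounded both by its piece and by its own length; adding these
    -- avoids an error term `r`.
    · have hMa : (M t : ℝ) ≤ (p (t + 1) : ℝ) - p t := by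
        have hx : ∀ s e : ℕ, s ≤ e → |signSum (bukhMaWord n r) e - signSum (bukhMaWord n r) s|
            ≤ (e : ℝ) - s := by
          intro s e hse
          induction e, hse using Nat.le_induction with
          | base => simp
          | succ e _ ih =>
            have := abs_signAt_le (bukhMaWord n r) e
            rw [signSum, Finset.sum_range_succ, ← signSum]
            push_cast
            rw [abs_le] at *
            constructor <;> linarith
        have := abs_le.1 (hx _ _ h1)
        rcases neg_one_pow_eq_or ℝ t with e | e <;> rw [e] at h3 <;> linarith
      have hMl : (M t : ℝ) ≤ (n % r' : ℕ) := by
        rw [runLength, ← hq, if_neg htq] at h2; exact_mod_cast h2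
      linarith
  have hsum := Finset.sum_le_sum hbound
  rw [Finset.sum_add_distrib, Finset.sum_range_sub (fun t => (p t : ℝ)), ← Finset.mul_sum,
    Finset.sum_range_succ (fun t => if t < q then (r : ℝ) else (n % r' : ℕ)),
    Finset.sum_congr rfl (g := fun _ => (r : ℝ))
      (fun t ht' => if_pos (Finset.mem_range.1 ht'))] at hsum
  simp only [lt_irrefl, if_false, Finset.sum_const, Finset.card_range, nsmul_eq_mul, hp0] at hsum
  have hMr : (n : ℝ) ≤ (∑ t ∈ Finset.range (q + 1), (M t : ℝ)) + d := by exact_mod_cast hM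
  have hpn : (p (q + 1) : ℝ) ≤ n := by exact_mod_cast hpT
  have hdm : (r' : ℝ) * q + (n % r' : ℕ) = n := by exact_mod_cast Nat.div_add_mod n r'
  push_cast at hsum
  nlinarith

/-! ### Block means and energy. -/

/-- The mean of `x` over the `k`-th block of length `B`. -/
noncomputable def blockMean (x : ℕ → ℝ) (B k : ℕ) : ℝ := (∑ i ∈ Finset.range B, x (B * k + i)) / B

theorem sum_range_mul (f : ℕ → ℝ) (B K : ℕ) :
    ∑ p ∈ Finset.range (B * K), f p =
      ∑ k ∈ Finset.range K, ∑ i ∈ Finset.range B, f (B * k + i) := by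
  induction K with
  | zero => simp
  | succ K ih => rw [mul_add, mul_one, Finset.sum_range_add, ih, Finset.sum_range_succ]

theorem mul_add_div_of_lt {B k i : ℕ} (hi : i < B) : (B * k + i) / B = k := by
  rw [Nat.mul_add_div (by omega), Nat.div_eq_of_lt hi, add_zero]

theorem sum_blockMean_mul (x g : ℕ → ℝ) {B : ℕ} (hB : 0 < B) (K : ℕ) :
    ∑ p ∈ Finset.range (B * K), blockMean x B (p / B) * g (p / B) =
      ∑ p ∈ Finset.range (B * K), x p * g (p / B) := by
  rw [sum_range_mul, sum_range_mul]
  refine Finset.sum_congr rfl fun k _ => ?_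
  have h : ∀ i ∈ Finset.range B, (B * k + i) / B = k := fun i hi =>
    mul_add_div_of_lt (Finset.mem_range.1 hi)
  calc ∑ i ∈ Finset.range B, blockMean x B ((B * k + i) / B) * g ((B * k + i) / B)
      = ∑ i ∈ Finset.range B, blockMean x B k * g k :=
        Finset.sum_congr rfl fun i hi => by rw [h i hi]
    _ = ∑ i ∈ Finset.range B, x (B * k + i) * g k := by
        have : (B : ℝ) ≠ 0 := by positivity
        rw [← Finset.sum_mul, Finset.sum_const, Finset.card_range, nsmul_eq_mul, blockMean]
        rw [← Finset.sum_mul]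
        field_simp
    _ = _ := Finset.sum_congr rfl fun i hi => by rw [h i hi]

/-- The square sum of the means of `x` over the blocks of length `B` that cover `range P`. -/
noncomputable def blockEnergy (x : ℕ → ℝ) (P B : ℕ) : ℝ :=
  ∑ p ∈ Finset.range P, blockMean x B (p / B) ^ 2

/-- Block averaging is an orthogonal projection, and for `h ∣ H` the coarse one factors through the
fine one, so Pythagoras applies. -/
theorem blockEnergy_sub (x : ℕ → ℝ) {h H P : ℕ} (hH : 0 < H) (h₁ : h ∣ H) (h₂ : H ∣ P) :
    ∑ p ∈ Finset.range P, (blockMean x h (p / h) - blockMean x H (p / H)) ^ 2 =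
      blockEnergy x P h - blockEnergy x P H := by
  obtain ⟨K, rfl⟩ := h₂
  obtain ⟨j, rfl⟩ := h₁
  have hh : 0 < h := Nat.pos_of_mul_pos_right hH
  have e1 := sum_blockMean_mul x (blockMean x (h * j)) hH K
  have e2 := sum_blockMean_mul x (fun k => blockMean x (h * j) (k / j)) hh (j * K)
  simp only [Nat.div_div_eq_div_mul, ← mul_assoc] at e2
  have : ∀ p ∈ Finset.range (h * j * K),
      (blockMean x h (p / h) - blockMean x (h * j) (p / (h * j))) ^ 2 =
      blockMean x h (p / h) ^ 2 - 2 * (blockMean x h (p / h) * blockMean x (h * j) (p / (h * j)))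
        + blockMean x (h * j) (p / (h * j)) * blockMean x (h * j) (p / (h * j)) := by
    intros; ring
  rw [Finset.sum_congr rfl this, Finset.sum_add_distrib, Finset.sum_sub_distrib, ← Finset.mul_sum,
    e2, e1, blockEnergy, blockEnergy]
  have e3 : ∑ p ∈ Finset.range (h * j * K), blockMean x (h * j) (p / (h * j)) ^ 2 =
      ∑ p ∈ Finset.range (h * j * K), x p * blockMean x (h * j) (p / (h * j)) := by
    rw [← e1]; exact Finset.sum_congr rfl fun p _ => sq _
  rw [e3]; ring

theorem abs_blockMean_le {x : ℕ → ℝ} (hx : ∀ p, |x p| ≤ 1) (B k : ℕ) : |blockMean x B k| ≤ 1 := by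
  rcases Nat.eq_zero_or_pos B with rfl | hB
  · simp [blockMean]
  have hB' : (0 : ℝ) < B := by exact_mod_cast hB
  rw [blockMean, abs_div, abs_of_pos hB', div_le_one hB']
  calc _ ≤ ∑ i ∈ Finset.range B, |x (B * k + i)| := Finset.abs_sum_le_sum_abs _ _
    _ ≤ ∑ i ∈ Finset.range B, 1 := Finset.sum_le_sum fun i _ => hx _
    _ = B := by simp

/-- Complete blocks cancel; only the last incomplete block contributes. -/
theorem abs_sum_sub_blockMean_le {x : ℕ → ℝ} (hx : ∀ p, |x p| ≤ 1) {B : ℕ} (hB : 0 < B) (s : ℕ) :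
    |∑ p ∈ Finset.range s, (x p - blockMean x B (p / B))| ≤ 2 * B := by
  have h0 := sum_blockMean_mul x (fun _ => 1) hB (s / B)
  simp only [mul_one] at h0
  have hs : ∑ p ∈ Finset.range s, (x p - blockMean x B (p / B)) =
      ∑ i ∈ Finset.range (s % B),
        (x (B * (s / B) + i) - blockMean x B ((B * (s / B) + i) / B)) := by
    conv_lhs => rw [← Nat.div_add_mod s B]
    rw [Finset.sum_range_add, Finset.sum_sub_distrib, h0, sub_self, zero_add]
  rw [hs]
  calc _ ≤ ∑ i ∈ Finset.range (s % B),
        |x (B * (s / B) + i) - blockMean x B ((B * (s / B) + i) / B)| :=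
      Finset.abs_sum_le_sum_abs _ _
    _ ≤ ∑ i ∈ Finset.range (s % B), 2 := Finset.sum_le_sum fun i _ => by
      have a := abs_le.1 (hx (B * (s / B) + i))
      have b := abs_le.1 (abs_blockMean_le hx B ((B * (s / B) + i) / B))
      rw [abs_le]; constructor <;> linarith [a.1, a.2, b.1, b.2]
    _ = 2 * (s % B : ℕ) := by simp [mul_comm]
    _ ≤ 2 * B := by
      have : ((s % B : ℕ) : ℝ) ≤ B := by exact_mod_cast (Nat.mod_lt s hB).le
      linarith

/-! ### The energy drop forced by one close codeword. -/

/-- The function `2 * b`, cut off at `-1` and `1`. -/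
noncomputable def clipDouble (b : ℝ) : ℝ := max (-1) (min 1 (2 * b))

theorem clipDouble_neg (b : ℝ) : clipDouble (-b) = -clipDouble b := by
  unfold clipDouble
  grind

theorem abs_clipDouble_le (b : ℝ) : |clipDouble b| ≤ 1 := by
  unfold clipDouble
  grind

/-- Here a run of length at most `r` has `M` matches in a piece of length `a` and bias `b`. The
bound is odd in `b`, so it cancels over consecutive runs of opposite symbols. Summing `3 * M - a -
r` over all runs produces the combination `n - 2 * d - i`, up to an error `r`. -/
theorem three_mul_le_clipDouble {M a r b : ℝ} (ha : 0 ≤ a) (hr : 0 ≤ r) (hb : |b| ≤ 1)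
    (h₁ : M ≤ r) (h₂ : 2 * M ≤ a * (1 + b)) : 3 * M - a - r ≤ r * clipDouble b := by
  obtain ⟨hb1, hb2⟩ := abs_le.1 hb
  unfold clipDouble
  rcases le_total 1 (2 * b) with h | h
  · rw [min_eq_left h, max_eq_right (by norm_num)]
    nlinarith
  rw [min_eq_right h]
  rcases le_total (2 * b) (-1) with h' | h'
  · rw [max_eq_left h']; nlinarith
  rw [max_eq_right h']
  rcases le_total (3 * b) (-1) with h'' | h''
  · nlinarith
  have hpos : 0 < 1 + b := by linarith
  -- The left side is at most `(1 + 3 * b) * M`, and `1 + 3 * b ≤ (1 + b) * (1 + 2 * b)`.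
  have key : (1 + b) * (3 * M - a) ≤ (1 + b) * (r * (1 + 2 * b)) := by
    have h3 : (1 + 3 * b) * M ≤ (1 + 3 * b) * r := mul_le_mul_of_nonneg_left h₁ (by linarith)
    nlinarith [mul_nonneg hr (sq_nonneg b)]
  linarith [le_of_mul_le_mul_left key hpos]

/-- An alternating sum of values of a sequence along a monotone sequence of indices. -/
theorem sum_neg_one_pow_mul_le (f : ℕ → ℝ) (hf : ∀ j, |f j| ≤ 1) (J : ℕ → ℕ) (T : ℕ)
    (hJ : ∀ t < T, J t ≤ J (t + 1)) :
    ∑ t ∈ Finset.range T, (-1) ^ t * f (J t) ≤ 2 * J T + 1 := by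
  -- While `J` is constant the terms cancel in pairs, and each increase of `J` costs at most 2; the
  -- parity term records the unpaired summand.
  have key : ∑ t ∈ Finset.range T, (-1) ^ t * f (J t) ≤
      2 * J T + if Even T then 0 else f (J T) := by
    induction T with
    | zero => simp
    | succ T ih =>
      have h := ih fun t ht => hJ t (by omega)
      have hT := hJ T (by omega)
      have hstep : f (J T) - f (J (T + 1)) ≤ 2 * ((J (T + 1) : ℝ) - J T) := by
        rcases hT.eq_or_lt with e | e
        · simp [e]
        · have : (J T : ℝ) + 1 ≤ J (T + 1) := by exact_mod_cast e
          have h1 := abs_le.1 (hf (J T))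
          have h2 := abs_le.1 (hf (J (T + 1)))
          linarith [h1.2, h2.1]
      have hT' : (J T : ℝ) ≤ J (T + 1) := by exact_mod_cast hT
      rw [Finset.sum_range_succ]
      by_cases hE : Even T
      · have : ¬ Even (T + 1) := by simpa [Nat.even_add_one] using hE
        rw [if_pos hE] at h; rw [if_neg this, hE.neg_one_pow]; linarith
      · have : Even (T + 1) := by simpa [Nat.even_add_one] using hE
        rw [if_neg hE] at h
        rw [if_pos this, (Nat.not_even_iff_odd.1 hE).neg_one_pow]; linarith
  refine key.trans ?_
  have := abs_le.1 (hf (J T))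
  split_ifs <;> linarith [this.2]

theorem Edits.le_sum_abs_blockMean_sub {n r h H d i : ℕ} {v : List Bool} (hn : 1 ≤ n) (hr : 1 ≤ r)
    (hH : 0 < H) (hhH : h ∣ H) (hE : Edits d i (bukhMaWord n r) v) :
    (n : ℝ) - 2 * d - i ≤
      3 / 2 * (∑ q ∈ Finset.range v.length,
        |blockMean (signAt v) h (q / h) - blockMean (signAt v) H (q / H)|) +
      6 * h * ((n / r : ℕ) + 1) + r * (5 * ((v.length : ℝ) / H) + 2) := by
  obtain ⟨p, M, hp0, hM, hpT, ht⟩ := hE.exists_cuts hn hr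
  have hlen := hE.length_add
  rw [length_bukhMaWord n r hr] at hlen
  have hh : 0 < h := Nat.pos_of_dvd_of_pos hhH hH
  set T := n / r + 1 with hTdef
  set x := signAt v with hx
  set y : ℕ → ℝ := fun q => blockMean x h (q / h) - blockMean x H (q / H) with hy
  set Y : ℕ → ℝ := fun s => ∑ q ∈ Finset.range s, |y q| with hY
  have hr0 : (0 : ℝ) ≤ r := Nat.cast_nonneg r
  have hY_mono : Monotone Y := fun s e hse =>
    Finset.sum_le_sum_of_subset_of_nonneg (Finset.range_mono hse) fun _ _ _ => abs_nonneg _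
  have hx1 : ∀ q, |x q| ≤ 1 := abs_signAt_le v
  have hstep : ∀ t ∈ Finset.range T, 3 * (M t : ℝ) - ((p (t + 1) : ℝ) - p t) - r ≤
      r * ((-1) ^ t * clipDouble (blockMean x H (p t / H))) +
      (3 / 2 * (Y (p (t + 1)) - Y (p t)) + 6 * h) +
      3 * r * (((p (t + 1) / H : ℕ) : ℝ) - (p t / H : ℕ)) := by
    intro t htm
    obtain ⟨h1, h2, h3⟩ := ht t (Finset.mem_range.1 htm)
    have hMr : (M t : ℝ) ≤ r := by
      have : runLength n r t ≤ r := by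
        unfold runLength; split_ifs
        · exact le_rfl
        · exact (Nat.mod_lt n hr).le
      exact_mod_cast h2.trans this
    have h1' : (p t : ℝ) ≤ p (t + 1) := by exact_mod_cast h1
    have hYt := hY_mono h1
    have hhr : (0 : ℝ) ≤ h := Nat.cast_nonneg h
    set β := blockMean x H (p t / H) with hβ
    have hβ1 : |β| ≤ 1 := abs_blockMean_le hx1 _ _
    rcases (Nat.div_le_div_right (c := H) h1).eq_or_lt with hJ | hJ
    -- Both cuts lie in the same `H`-block, so the piece has bias `β` up to the variation of `y` and
    -- `2 * h` at each end. Half of this error is subtracted from `M t` below.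
    · have hconst : ∀ q ∈ Finset.Ico (p t) (p (t + 1)), blockMean x H (q / H) = β := by
        intro q hq
        obtain ⟨q1, q2⟩ := Finset.mem_Ico.1 hq
        have a1 := Nat.div_le_div_right (c := H) q1
        have a2 := Nat.div_le_div_right (c := H) q2.le
        rw [hβ, show q / H = p t / H by omega]
      have e1 : signSum v (p (t + 1)) - signSum v (p t) =
          (∑ q ∈ Finset.range (p (t + 1)), (x q - blockMean x h (q / h)) -
            ∑ q ∈ Finset.range (p t), (x q - blockMean x h (q / h))) +
          ∑ q ∈ Finset.Ico (p t) (p (t + 1)), y q + ((p (t + 1) : ℝ) - p t) * β := by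
        have e3 : ∑ q ∈ Finset.Ico (p t) (p (t + 1)), β = ((p (t + 1) : ℝ) - p t) * β := by
          rw [Finset.sum_const, Nat.card_Ico, nsmul_eq_mul, Nat.cast_sub h1]
        rw [signSum, signSum, ← Finset.sum_Ico_eq_sub _ h1, ← Finset.sum_Ico_eq_sub _ h1, ← e3,
          ← Finset.sum_add_distrib, ← Finset.sum_add_distrib]
        refine Finset.sum_congr rfl fun q hq => ?_
        simp only [hy, hconst q hq]; ring
      have e2 : |∑ q ∈ Finset.Ico (p t) (p (t + 1)), y q| ≤ Y (p (t + 1)) - Y (p t) := by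
        rw [hY, ← Finset.sum_Ico_eq_sub _ h1]
        exact Finset.abs_sum_le_sum_abs _ _
      have b1 := abs_le.1 (abs_sum_sub_blockMean_le hx1 hh (p (t + 1)))
      have b2 := abs_le.1 (abs_sum_sub_blockMean_le hx1 hh (p t))
      have b3 := abs_le.1 e2
      rw [hJ, sub_self, mul_zero, add_zero]
      rw [e1] at h3
      have ha : (0 : ℝ) ≤ (p (t + 1) : ℝ) - p t := by linarith
      rcases neg_one_pow_eq_or ℝ t with e | e
      · rw [e] at h3 ⊢
        have := three_mul_le_clipDouble
          (M := M t - (4 * h + (Y (p (t + 1)) - Y (p t))) / 2) ha hr0 hβ1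
          (by linarith) (by linarith [b1.2, b2.1, b3.2])
        linarith
      · rw [e] at h3 ⊢
        have := three_mul_le_clipDouble (b := -β)
          (M := M t - (4 * h + (Y (p (t + 1)) - Y (p t))) / 2) ha hr0 (by rwa [abs_neg])
          (by linarith) (by linarith [b1.1, b2.2, b3.1])
        rw [clipDouble_neg] at this
        linarith
    -- A piece ending in a later block gets the trivial bound `2 * r`, so `3 * r` covers the loss
    -- against a clipped term of at least `-r`.
    · have hJ' : ((p t / H : ℕ) : ℝ) + 1 ≤ (p (t + 1) / H : ℕ) := by exact_mod_cast hJ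
      have hc := abs_le.1 (abs_clipDouble_le β)
      have hrc : -(r : ℝ) ≤ r * ((-1) ^ t * clipDouble β) := by
        rcases neg_one_pow_eq_or ℝ t with e | e <;> rw [e] <;> nlinarith [hc.1, hc.2]
      nlinarith
  have hsum := Finset.sum_le_sum hstep
  have halt := sum_neg_one_pow_mul_le (fun j => clipDouble (blockMean x H j))
    (fun j => abs_clipDouble_le _) (fun t => p t / H) T
    (fun t htT => Nat.div_le_div_right (ht t htT).1)
  rw [Finset.sum_sub_distrib, Finset.sum_sub_distrib, Finset.sum_add_distrib,
    Finset.sum_add_distrib, Finset.sum_add_distrib, ← Finset.mul_sum, ← Finset.mul_sum,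
    ← Finset.mul_sum, ← Finset.mul_sum, ← Finset.mul_sum,
    Finset.sum_range_sub (fun t => (p t : ℝ)),
    Finset.sum_range_sub (fun t => Y (p t)),
    Finset.sum_range_sub (fun t => ((p t / H : ℕ) : ℝ))] at hsum
  simp only [Finset.sum_const, Finset.card_range, nsmul_eq_mul, hp0, Nat.zero_div, Nat.cast_zero,
    sub_zero] at hsum
  have hY0 : Y 0 = 0 := by simp [hY]
  have hYT : Y (p T) ≤ Y v.length := hY_mono hpT
  have hMr : (n : ℝ) ≤ (∑ t ∈ Finset.range T, (M t : ℝ)) + d := by exact_mod_cast hM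
  have hlen' : (v.length : ℝ) + d = n + i := by exact_mod_cast hlen
  have hpT' : (p T : ℝ) ≤ v.length := by exact_mod_cast hpT
  have hT' : (T : ℝ) * r ≤ n + r := by
    have : T * r ≤ n + r := by
      rw [hTdef, add_mul, one_mul]; exact Nat.add_le_add_right (Nat.div_mul_le_self n r) r
    exact_mod_cast this
  have hTc : (T : ℝ) = (n / r : ℕ) + 1 := by rw [hTdef]; push_cast; rfl
  have hJT : ((p T / H : ℕ) : ℝ) ≤ (v.length : ℝ) / H :=
    Nat.cast_div_le.trans (by gcongr)
  have halt' := mul_le_mul_of_nonneg_left halt hr0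
  have hJr := mul_le_mul_of_nonneg_left hJT hr0
  rw [← hTc]
  linarith

theorem Edits.blockEnergy_drop {n r d i P a b : ℕ} {ε : ℝ} {v : List Bool} (hε : 0 < ε)
    (hn : 1 ≤ n) (hr : 1 ≤ r) (hE : Edits d i (bukhMaWord n r) v)
    (hadv : 2 * (d : ℝ) + i < (1 - ε) * n) (hab : a ≤ b) (hbP : 2 ^ b ∣ P) (hP : v.length ≤ P)
    (hrn : 16 * (r : ℝ) ≤ ε * n) (ha : 96 * (2 : ℝ) ^ a ≤ ε * r) (hb : 80 * (r : ℝ) ≤ ε * 2 ^ b) :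
    2 / 25 * ε ^ 2 * n ≤
      blockEnergy (signAt v) P (2 ^ a) - blockEnergy (signAt v) P (2 ^ b) := by
  have hmain := hE.le_sum_abs_blockMean_sub hn hr (pow_pos two_pos b) (pow_dvd_pow 2 hab)
  have hlen := hE.length_add
  rw [length_bukhMaWord n r hr] at hlen
  rw [← blockEnergy_sub (signAt v) (pow_pos two_pos b) (pow_dvd_pow 2 hab) hbP]
  set f : ℕ → ℝ := fun q => blockMean (signAt v) (2 ^ a) (q / 2 ^ a) -
    blockMean (signAt v) (2 ^ b) (q / 2 ^ b) with hf
  have hn0 : (0 : ℝ) < n := by exact_mod_cast hn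
  have hr0 : (0 : ℝ) < r := by exact_mod_cast hr
  have hm : (v.length : ℝ) ≤ 2 * n := by
    have : (v.length : ℝ) + d = n + i := by exact_mod_cast hlen
    have hd : (0 : ℝ) ≤ d := Nat.cast_nonneg d
    nlinarith
  have t1 : 6 * ((2 ^ a : ℕ) : ℝ) * ((n / r : ℕ) + 1) ≤ ε * n / 8 := by
    have h1 : ((n / r : ℕ) : ℝ) ≤ n / r := Nat.cast_div_le
    have h2 : (1 : ℝ) ≤ n / r := by
      rw [le_div_iff₀ hr0]
      have hd : (0 : ℝ) ≤ d := Nat.cast_nonneg d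
      have hi : (0 : ℝ) ≤ i := Nat.cast_nonneg i
      nlinarith
    have h3 : 6 * (2 : ℝ) ^ a * ((n / r : ℕ) + 1) ≤ 6 * (2 : ℝ) ^ a * (2 * (n / r)) := by
      gcongr; linarith
    have h4 : 96 * (2 : ℝ) ^ a * (n / r) ≤ ε * r * (n / r) := by gcongr
    have h5 : ε * r * ((n : ℝ) / r) = ε * n := by field_simp
    push_cast
    linarith
  have t2 : (r : ℝ) * (5 * ((v.length : ℝ) / (2 ^ b : ℕ)) + 2) ≤ ε * n / 4 := by
    have hb0 : (0 : ℝ) < 2 ^ b := by positivity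
    have h1 : (r : ℝ) * (5 * ((v.length : ℝ) / 2 ^ b)) ≤ ε * n / 8 := by
      rw [← mul_assoc, ← mul_div_assoc, div_le_iff₀ hb0]
      have h2 : (r : ℝ) * 5 * v.length ≤ r * 5 * (2 * n) := by gcongr
      have h3 : 80 * (r : ℝ) * n ≤ ε * 2 ^ b * n := by gcongr
      linarith
    push_cast
    linarith
  -- The errors `t1` and `t2` leave `5 / 8` of `ε * n`; dividing by `3 / 2` gives `5 / 12`, which
  -- exceeds `2 / 5`. Cauchy-Schwarz then turns this into energy.
  have hS : 2 / 5 * (ε * n) ≤ ∑ q ∈ Finset.range v.length, |f q| := by linarith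
  have hcs := sq_sum_le_card_mul_sum_sq (s := Finset.range v.length) (f := fun q => |f q|)
  simp only [sq_abs, Finset.card_range] at hcs
  have hsub : ∑ q ∈ Finset.range v.length, f q ^ 2 ≤ ∑ q ∈ Finset.range P, f q ^ 2 :=
    Finset.sum_le_sum_of_subset_of_nonneg (Finset.range_mono hP) fun _ _ _ => sq_nonneg _
  have hsq : (2 / 5 * (ε * n)) ^ 2 ≤ (∑ q ∈ Finset.range v.length, |f q|) ^ 2 :=
    pow_le_pow_left₀ (by positivity) hS 2
  have hle : (v.length : ℝ) * ∑ q ∈ Finset.range v.length, f q ^ 2 ≤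
      2 * n * ∑ q ∈ Finset.range P, f q ^ 2 := by
    have : 0 ≤ ∑ q ∈ Finset.range v.length, f q ^ 2 := Finset.sum_nonneg fun _ _ => sq_nonneg _
    gcongr
  have hfin : n * (2 / 25 * ε ^ 2 * n) ≤ n * ∑ q ∈ Finset.range P, f q ^ 2 := by linarith
  exact le_of_mul_le_mul_left hfin hn0

/-! ### Counting separated half-periods. -/

theorem card_mul_le_of_drops {Q : ℕ → ℝ} {N : ℕ} (hQ : ∀ c c', c ≤ c' → c' ≤ N → Q c' ≤ Q c)
    (a b : ℕ → ℕ) (g : ℝ) (S : Finset ℕ)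
    (hg : ∀ r ∈ S, a r ≤ b r ∧ b r ≤ N ∧ g ≤ Q (a r) - Q (b r))
    (hab : ∀ r ∈ S, ∀ r' ∈ S, r < r' → b r ≤ a r') :
    ∀ c ≤ N, (∀ r ∈ S, b r ≤ c) → (S.card : ℝ) * g ≤ Q 0 - Q c := by
  induction S using Finset.induction_on_max with
  | empty => intro c hc _; simpa using hQ 0 c (Nat.zero_le _) hc
  | insert k S hk ih =>
    intro c hc hbc
    obtain ⟨h1, h2, h3⟩ := hg k (Finset.mem_insert_self _ _)
    have hkS : k ∉ S := fun h => lt_irrefl _ (hk k h)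
    have h4 := ih (fun r hr => hg r (Finset.mem_insert_of_mem hr))
      (fun r hr r' hr' => hab r (Finset.mem_insert_of_mem hr) r' (Finset.mem_insert_of_mem hr'))
      (a k) (h1.trans h2) (fun r hr =>
        hab r (Finset.mem_insert_of_mem hr) k (Finset.mem_insert_self _ _) (hk r hr))
    have h5 := hQ (b k) c (hbc k (Finset.mem_insert_self _ _)) hc
    rw [Finset.card_insert_of_notMem hkS]
    push_cast
    linarith

theorem blockEnergy_one_le (v : List Bool) (P : ℕ) :
    blockEnergy (signAt v) P 1 ≤ v.length := by
  have h : ∀ p ∈ Finset.range P, blockMean (signAt v) 1 (p / 1) ^ 2 ≤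
      if p < v.length then (1 : ℝ) else 0 := by
    intro p _
    have : blockMean (signAt v) 1 (p / 1) = signAt v p := by simp [blockMean]
    rw [this]
    split_ifs with hp
    · exact (sq_le_one_iff_abs_le_one _).2 (abs_signAt_le v p)
    · simp [signAt, List.getElem?_eq_none (not_lt.1 hp)]
  refine (Finset.sum_le_sum h).trans ?_
  rw [Finset.sum_ite, Finset.sum_const_zero, add_zero, Finset.sum_const, nsmul_eq_mul, mul_one]
  have : (Finset.range P).filter (· < v.length) ⊆ Finset.range v.length := fun p hp => by
    simpa using (Finset.mem_filter.1 hp).2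
  exact_mod_cast (Finset.card_le_card this).trans (Finset.card_range _).le

theorem exists_two_pow_scales {ε : ℝ} (hε : 0 < ε) (hε1 : ε ≤ 1) {r : ℕ} (hr : 96 ≤ ε * r) :
    ∃ a b : ℕ, a ≤ b ∧ 96 * (2 : ℝ) ^ a ≤ ε * r ∧ ε * r < 192 * (2 : ℝ) ^ a ∧
      80 * (r : ℝ) ≤ ε * 2 ^ b ∧ ε * 2 ^ b ≤ 160 * r := by
  have hr0 : (0 : ℝ) < r := by
    by_contra h
    have : (r : ℝ) = 0 := le_antisymm (not_lt.1 h) (Nat.cast_nonneg r)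
    rw [this] at hr; linarith
  have hεr : ε * r ≤ r := mul_le_of_le_one_left hr0.le hε1
  obtain ⟨a, ha1, ha2⟩ := exists_nat_pow_near (x := ε * r / 96) (y := (2 : ℝ))
    (by linarith) one_lt_two
  obtain ⟨b, hb1, hb2⟩ := exists_nat_pow_near (x := 80 * (r : ℝ) / ε) (y := (2 : ℝ))
    (by rw [le_div_iff₀ hε]; linarith) one_lt_two
  rw [le_div_iff₀ hε] at hb1
  rw [div_lt_iff₀ hε] at hb2
  rw [pow_succ] at ha2
  refine ⟨a, b + 1, ?_, by linarith, by linarith, by linarith, by rw [pow_succ]; linarith⟩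
  have hlt : (2 : ℝ) ^ a < 2 ^ (b + 1) := by
    have : ε * (2 : ℝ) ^ (b + 1) ≤ 2 ^ (b + 1) := mul_le_of_le_one_left (by positivity) hε1
    linarith
  exact ((pow_lt_pow_iff_right₀ one_lt_two).1 hlt).le

/-- At most `O(1 / ε ^ 2)` words with widely separated half-periods are close to `v`. -/
theorem card_le_of_separated {n : ℕ} {ε : ℝ} {v : List Bool} (hε : 0 < ε) (hε1 : ε ≤ 1)
    (hn : 1 ≤ n) (S : Finset ℕ) (hS : ∀ r ∈ S, 1 ≤ r ∧ r ≤ n)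
    (hgap : ∀ r ∈ S, ∀ r' ∈ S, r < r' → 30720 * (r : ℝ) ≤ ε ^ 2 * r')
    (hE : ∀ r ∈ S, ∃ d i : ℕ, Edits d i (bukhMaWord n r) v ∧ 2 * (d : ℝ) + i < (1 - ε) * n) :
    (S.card : ℝ) ≤ 25 / ε ^ 2 + 2 := by
  have hεsq : ε ^ 2 ≤ ε := by nlinarith
  have hlow : (S.filter fun r : ℕ => ε * r < 96).card ≤ 1 := by
    refine Finset.card_le_one.2 fun r hr r' hr' => ?_
    wlog hlt : r < r' generalizing r r'
    · rcases (not_lt.1 hlt).eq_or_lt with h | h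
      · exact h.symm
      · exact (this r' hr' r hr h).symm
    obtain ⟨m1, -⟩ := Finset.mem_filter.1 hr
    obtain ⟨m2, l2⟩ := Finset.mem_filter.1 hr'
    have h1 : (1 : ℝ) ≤ r := by exact_mod_cast (hS r m1).1
    have h2 := hgap r m1 r' m2 hlt
    have h3 : ε ^ 2 * r' ≤ ε * r' := by gcongr
    linarith
  have hhigh : (S.filter fun r : ℕ => ε * n < 16 * (r : ℝ)).card ≤ 1 := by
    refine Finset.card_le_one.2 fun r hr r' hr' => ?_
    wlog hlt : r < r' generalizing r r'
    · rcases (not_lt.1 hlt).eq_or_lt with h | h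
      · exact h.symm
      · exact (this r' hr' r hr h).symm
    obtain ⟨m1, l1⟩ := Finset.mem_filter.1 hr
    obtain ⟨m2, -⟩ := Finset.mem_filter.1 hr'
    have h1 : (r' : ℝ) ≤ n := by exact_mod_cast (hS r' m2).2
    have h2 := hgap r m1 r' m2 hlt
    have h3 : ε ^ 2 * r' ≤ ε * n := by gcongr
    have h4 : (0 : ℝ) ≤ r := Nat.cast_nonneg r
    linarith
  set S' := S.filter fun r : ℕ => 96 ≤ ε * r ∧ 16 * (r : ℝ) ≤ ε * n with hS'
  have hmid : (S'.card : ℝ) ≤ 25 / ε ^ 2 := by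
    rcases S'.eq_empty_or_nonempty with h0 | ⟨r₀, hr₀⟩
    · rw [h0]; simp; positivity
    have hsc : ∀ r : ℕ, ∃ ab : ℕ × ℕ, r ∈ S' → ab.1 ≤ ab.2 ∧ 96 * (2 : ℝ) ^ ab.1 ≤ ε * r ∧
        ε * r < 192 * (2 : ℝ) ^ ab.1 ∧ 80 * (r : ℝ) ≤ ε * 2 ^ ab.2 ∧ ε * 2 ^ ab.2 ≤ 160 * r := by
      intro r
      by_cases hr : r ∈ S'
      · obtain ⟨a, b, h⟩ := exists_two_pow_scales hε hε1 (Finset.mem_filter.1 hr).2.1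
        exact ⟨(a, b), fun _ => h⟩
      · exact ⟨(0, 0), fun h => absurd h hr⟩
    choose ab hab using hsc
    -- Then `2 ^ N` is a multiple of every block length in use and at least `v.length`; the signs
    -- are zero beyond `v`, so padding costs no energy.
    set N := S'.sup (fun r => (ab r).2) + v.length with hN
    have hbN : ∀ r ∈ S', (ab r).2 ≤ N := fun r hr =>
      (Finset.le_sup (f := fun r => (ab r).2) hr).trans (Nat.le_add_right _ _)
    have hvN : v.length ≤ 2 ^ N :=
      (Nat.lt_two_pow_self).le.trans (Nat.pow_le_pow_right two_pos (Nat.le_add_left _ _))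
    have hdrop := card_mul_le_of_drops (Q := fun c => blockEnergy (signAt v) (2 ^ N) (2 ^ c))
      (N := N) (fun c c' hc hc' => by
        have := blockEnergy_sub (signAt v) (pow_pos two_pos c') (pow_dvd_pow 2 hc)
          (pow_dvd_pow 2 hc')
        have h0 : 0 ≤ blockEnergy (signAt v) (2 ^ N) (2 ^ c) -
            blockEnergy (signAt v) (2 ^ N) (2 ^ c') := by
          rw [← this]; exact Finset.sum_nonneg fun _ _ => sq_nonneg _
        linarith)
      (fun r => (ab r).1) (fun r => (ab r).2) (2 / 25 * ε ^ 2 * n) S'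
      (fun r hr => by
        obtain ⟨h1, h2, -, h4, -⟩ := hab r hr
        obtain ⟨hrS, -, hrn⟩ := Finset.mem_filter.1 hr
        obtain ⟨d, i, hed, hadv⟩ := hE r hrS
        exact ⟨h1, hbN r hr, hed.blockEnergy_drop hε hn (hS r hrS).1 hadv h1
          (pow_dvd_pow 2 (hbN r hr)) hvN hrn h2 h4⟩)
      -- The gap constant is `30720 = 160 * 192`, from the upper bound on the coarse scale of `r`
      -- and the lower bound on the fine scale of `r'`.
      (fun r hr r' hr' hlt => by
        obtain ⟨-, -, -, -, h5⟩ := hab r hr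
        obtain ⟨-, -, h3, -, -⟩ := hab r' hr'
        have hg := hgap r (Finset.mem_filter.1 hr).1 r' (Finset.mem_filter.1 hr').1 hlt
        have h6 : ε * (ε * r') < ε * (192 * (2 : ℝ) ^ (ab r').1) := by gcongr
        have h7 : ε * (2 : ℝ) ^ (ab r).2 < ε * 2 ^ (ab r').1 := by linarith
        exact ((pow_lt_pow_iff_right₀ one_lt_two).1 (lt_of_mul_lt_mul_left h7 hε.le)).le)
      N le_rfl hbN
    have hQN : 0 ≤ blockEnergy (signAt v) (2 ^ N) (2 ^ N) :=
      Finset.sum_nonneg fun _ _ => sq_nonneg _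
    have hQ0 := blockEnergy_one_le v (2 ^ N)
    obtain ⟨d, i, hed, hadv⟩ := hE r₀ (Finset.mem_filter.1 hr₀).1
    have hlen := hed.length_add
    rw [length_bukhMaWord n r₀ (hS r₀ (Finset.mem_filter.1 hr₀).1).1] at hlen
    have hn0 : (0 : ℝ) < n := by exact_mod_cast hn
    have hm : (v.length : ℝ) ≤ 2 * n := by
      have : (v.length : ℝ) + d = n + i := by exact_mod_cast hlen
      have hd : (0 : ℝ) ≤ d := Nat.cast_nonneg d
      nlinarith
    simp only [pow_zero] at hdrop
    rw [le_div_iff₀ (by positivity)]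
    have hfin : (n : ℝ) * (S'.card * ε ^ 2) ≤ n * 25 := by linarith
    exact le_of_mul_le_mul_left hfin hn0
  have hcover : S ⊆ S' ∪ ((S.filter fun r : ℕ => ε * r < 96) ∪
      S.filter fun r : ℕ => ε * n < 16 * (r : ℝ)) := by
    intro r hr
    simp only [hS', Finset.mem_union, Finset.mem_filter, hr, true_and]
    rcases lt_or_ge (ε * r) 96 with h | h
    · exact .inr (.inl h)
    · rcases lt_or_ge (ε * n) (16 * (r : ℝ)) with h' | h'
      · exact .inr (.inr h')
      · exact .inl ⟨h, h'⟩
  have hcard : S.card ≤ S'.card + 2 := by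
    have h1 := Finset.card_le_card hcover
    have h2 := Finset.card_union_le S' ((S.filter fun r : ℕ => ε * r < 96) ∪
      S.filter fun r : ℕ => ε * n < 16 * (r : ℝ))
    have h3 := Finset.card_union_le (S.filter fun r : ℕ => ε * r < 96)
      (S.filter fun r : ℕ => ε * n < 16 * (r : ℝ))
    omega
  have : (S.card : ℝ) ≤ S'.card + 2 := by exact_mod_cast hcard
  linarith

/-! ### From separated half-periods to the code, for `ε` away from 1. -/

theorem one_le_floor_pow {q : ℝ} (hq : 1 ≤ q) (k : ℕ) : 1 ≤ ⌊q ^ k⌋₊ :=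
  (Nat.one_le_floor_iff _).2 (one_le_pow₀ hq)

theorem floor_pow_le {q : ℝ} (hq : 1 ≤ q) {k n : ℕ} (h : q ^ k < n) : ⌊q ^ k⌋₊ ≤ n := by
  have : (⌊q ^ k⌋₊ : ℝ) ≤ n := (Nat.floor_le (by positivity)).trans h.le
  exact_mod_cast this

theorem card_image_le_of_le {n : ℕ} {ε q : ℝ} {v : List Bool} (hε : 0 < ε) (hε1 : ε ≤ 13 / 14)
    (hq : q = 1 / ε ^ 4) (hn : 1 ≤ n) (K : Finset ℕ) (hK : ∀ k ∈ K, q ^ k < n)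
    (hE : ∀ k ∈ K, ∃ d i : ℕ, Edits d i (bukhMaWord n ⌊q ^ k⌋₊) v ∧
      2 * (d : ℝ) + i < (1 - ε) * n) :
    ((K.image fun k => ⌊q ^ k⌋₊).card : ℝ) ≤ 200000000 / ε ^ 2 := by
  have hε4 : ε ^ 4 ≤ 1 := pow_le_one₀ hε.le (by linarith)
  have hq1 : 1 ≤ q := by rw [hq, one_le_div (by positivity)]; exact hε4
  -- For `ε` above `1 / 250` the weaker advantage `1 / 250` suffices, and 80 steps of ratio `q ≥ (14
  -- / 13) ^ 4` give the gap. The constant `61440` is twice `30720`, as rounding down can halve a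
  -- half-period.
  obtain ⟨η, hη, hηε, hη1, hηq, hηinv⟩ : ∃ η : ℝ, 0 < η ∧ η ≤ ε ∧ η ≤ 1 ∧
      61440 ≤ η ^ 2 * q ^ 80 ∧ ε ≤ 250 * η := by
    rcases le_total ε (1 / 250) with h | h
    · refine ⟨ε, hε, le_rfl, by linarith, ?_, by linarith⟩
      have h1 : q ≤ q ^ 80 := le_self_pow₀ hq1 (by norm_num)
      have h2 : ε ^ 2 * q = 1 / ε ^ 2 := by rw [hq]; field_simp
      have h3 : ε ^ 2 ≤ (1 / 250) ^ 2 := by gcongr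
      have h4 : (61440 : ℝ) ≤ 1 / ε ^ 2 := by
        rw [le_div_iff₀ (by positivity)]; linarith
      calc (61440 : ℝ) ≤ ε ^ 2 * q := h2 ▸ h4
        _ ≤ ε ^ 2 * q ^ 80 := by gcongr
    · refine ⟨1 / 250, by norm_num, h, by norm_num, ?_, by linarith⟩
      have h1 : (14 / 13 : ℝ) ^ 4 ≤ q := by
        rw [hq, le_div_iff₀ (by positivity), ← mul_pow]
        exact pow_le_one₀ (by positivity) (by linarith)
      have h2 : ((14 / 13 : ℝ) ^ 4) ^ 80 ≤ q ^ 80 := by gcongr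
      have h3 : (61440 * 62500 : ℝ) ≤ ((14 / 13 : ℝ) ^ 4) ^ 80 := by norm_num
      linarith
  have hmono : Monotone fun k : ℕ => ⌊q ^ k⌋₊ := fun k k' h =>
    Nat.floor_le_floor (pow_le_pow_right₀ hq1 h)
  have hclass : ∀ c ∈ Finset.range 80,
      ((K.filter fun k => k % 80 = c).image fun k => ⌊q ^ k⌋₊).card ≤ ⌊25 / η ^ 2 + 2⌋₊ := by
    intro c _
    refine Nat.le_floor (card_le_of_separated hη hη1 hn _ ?_ ?_ ?_ (v := v))
    · intro r hr
      obtain ⟨k, hk, rfl⟩ := Finset.mem_image.1 hr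
      exact ⟨one_le_floor_pow hq1 k, floor_pow_le hq1 (hK k (Finset.mem_filter.1 hk).1)⟩
    · intro r hr r' hr' hlt
      obtain ⟨k, hk, rfl⟩ := Finset.mem_image.1 hr
      obtain ⟨k', hk', rfl⟩ := Finset.mem_image.1 hr'
      have hkk : k < k' := hmono.reflect_lt hlt
      have h1 := (Finset.mem_filter.1 hk).2
      have h2 := (Finset.mem_filter.1 hk').2
      have h3 : k + 80 ≤ k' := by omega
      have h4 : q ^ k * q ^ 80 ≤ q ^ k' := by rw [← pow_add]; exact pow_le_pow_right₀ hq1 h3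
      have h5 : (⌊q ^ k⌋₊ : ℝ) ≤ q ^ k := Nat.floor_le (by positivity)
      have h6 := Nat.lt_floor_add_one (q ^ k')
      have h7 : (1 : ℝ) ≤ ⌊q ^ k'⌋₊ := by exact_mod_cast one_le_floor_pow hq1 k'
      have h8 : η ^ 2 * (q ^ k * q ^ 80) ≤ η ^ 2 * (2 * ⌊q ^ k'⌋₊) :=
        mul_le_mul_of_nonneg_left (by linarith) (by positivity)
      have h9 : 61440 * q ^ k ≤ η ^ 2 * q ^ 80 * q ^ k := by gcongr
      linarith
    · intro r hr
      obtain ⟨k, hk, rfl⟩ := Finset.mem_image.1 hr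
      obtain ⟨d, i, hed, hadv⟩ := hE k (Finset.mem_filter.1 hk).1
      refine ⟨d, i, hed, hadv.trans_le ?_⟩
      gcongr
  have hsub : (K.image fun k => ⌊q ^ k⌋₊) ⊆ (Finset.range 80).biUnion fun c =>
      (K.filter fun k => k % 80 = c).image fun k => ⌊q ^ k⌋₊ := by
    intro r hr
    obtain ⟨k, hk, rfl⟩ := Finset.mem_image.1 hr
    exact Finset.mem_biUnion.2 ⟨k % 80, Finset.mem_range.2 (Nat.mod_lt _ (by norm_num)),
      Finset.mem_image.2 ⟨k, Finset.mem_filter.2 ⟨hk, rfl⟩, rfl⟩⟩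
  have hcard := (Finset.card_le_card hsub).trans (Finset.card_biUnion_le_card_mul _ _ _ hclass)
  rw [Finset.card_range] at hcard
  have hcard' : ((K.image fun k => ⌊q ^ k⌋₊).card : ℝ) ≤ 80 * (25 / η ^ 2 + 2) := by
    have h1 : ((K.image fun k => ⌊q ^ k⌋₊).card : ℝ) ≤ 80 * (⌊25 / η ^ 2 + 2⌋₊ : ℝ) := by
      exact_mod_cast hcard
    have h2 : (⌊25 / η ^ 2 + 2⌋₊ : ℝ) ≤ 25 / η ^ 2 + 2 := Nat.floor_le (by positivity)
    linarith
  refine hcard'.trans ?_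
  have h1 : ε ^ 2 ≤ (250 * η) ^ 2 := by gcongr
  have h2 : 25 / η ^ 2 ≤ 1562500 / ε ^ 2 := by
    rw [div_le_div_iff₀ (by positivity) (by positivity)]; linarith
  have h3 : 2 ≤ 2 / ε ^ 2 := by
    rw [le_div_iff₀ (by positivity)]
    have : ε ^ 2 ≤ 1 := pow_le_one₀ hε.le (by linarith)
    linarith
  have h4 : 1562500 / ε ^ 2 + 2 / ε ^ 2 ≤ 2500000 / ε ^ 2 := by
    rw [← add_div]; gcongr; norm_num
  have h5 : 80 * (2500000 / ε ^ 2) = 200000000 / ε ^ 2 := by ring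
  linarith

/-! ### The case of `ε` near 1. -/

/-- Close words have half-periods of almost the same size. -/
theorem sub_le_of_edits {n r r' d i d' i' : ℕ} {s : ℝ} {v : List Bool} (hr : 1 ≤ r) (hrr : r ≤ r')
    (hrn : r' ≤ n) (hE : Edits d i (bukhMaWord n r) v) (hE' : Edits d' i' (bukhMaWord n r') v)
    (h : 2 * (d : ℝ) + i < s * n) (h' : 2 * (d' : ℝ) + i' < s * n) :
    (r' : ℝ) - r ≤ 6 * s * r' := by
  have hr' : 1 ≤ r' := hr.trans hrr
  have key := (hE'.trans hE.symm).le_two_mul_of_bukhMaWord (hr'.trans hrn) hr hrr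
  have hq1 : 1 ≤ n / r' := (Nat.one_le_div_iff hr').2 hrn
  have hq : (n : ℝ) ≤ 2 * (r' * (n / r' : ℕ)) := by
    have h1 := Nat.div_add_mod n r'
    have h2 := Nat.mod_lt n hr'
    have h3 : n ≤ 2 * (r' * (n / r')) := by nlinarith
    exact_mod_cast h3
  have hd : (0 : ℝ) ≤ d := Nat.cast_nonneg d
  have hi' : (0 : ℝ) ≤ i' := Nat.cast_nonneg i'
  have hn0 : (0 : ℝ) < n := by exact_mod_cast hr'.trans hrn
  have hr0 : (0 : ℝ) < r' := by exact_mod_cast hr'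
  have hsub : (0 : ℝ) ≤ (r' : ℝ) - r := by
    have : (r : ℝ) ≤ r' := by exact_mod_cast hrr
    linarith
  push_cast at key
  have h1 : (n : ℝ) * (r' - r) ≤ 2 * (r' * (n / r' : ℕ)) * (r' - r) := by gcongr
  -- Passing from the longer half-period to the shorter through `v` deletes `d' + i` symbols, and `2
  -- * (d' + i) ≤ 3 * s * n`.
  have h2 : (r' : ℝ) * ((n / r' : ℕ) * (r' - r)) ≤ r' * (3 * (s * n)) :=
    mul_le_mul_of_nonneg_left (by linarith) hr0.le
  have h3 : (n : ℝ) * (r' - r) ≤ n * (6 * s * r') := by linarith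
  exact le_of_mul_le_mul_left h3 hn0

theorem card_image_le_of_ge {n : ℕ} {ε q : ℝ} {v : List Bool} (hε : 13 / 14 ≤ ε) (hε1 : ε < 1)
    (hq : q = 1 / ε ^ 4) (K : Finset ℕ) (hK : ∀ k ∈ K, q ^ k < n)
    (hE : ∀ k ∈ K, ∃ d i : ℕ, Edits d i (bukhMaWord n ⌊q ^ k⌋₊) v ∧
      2 * (d : ℝ) + i < (1 - ε) * n) :
    (K.image fun k => ⌊q ^ k⌋₊).card ≤ 7 := by
  have hε0 : 0 < ε := by linarith
  obtain ⟨s, rfl⟩ : ∃ s, ε = 1 - s := ⟨1 - ε, by ring⟩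
  have hs0 : 0 < s := by linarith
  have hs1 : s ≤ 1 / 14 := by linarith
  rw [sub_sub_cancel] at hE
  have hq4 : 1 + 4 * s ≤ q := by
    rw [hq, le_div_iff₀ (by positivity)]
    have h1 : (1 + 4 * s) ≤ (1 + s) ^ 4 := by
      have := one_add_mul_le_pow (a := s) (by linarith) 4
      norm_num at this; linarith
    calc (1 + 4 * s) * (1 - s) ^ 4 ≤ (1 + s) ^ 4 * (1 - s) ^ 4 := by gcongr
      _ = (1 - s ^ 2) ^ 4 := by ring
      _ ≤ 1 := pow_le_one₀ (by nlinarith) (by nlinarith)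
  have hq1 : 1 ≤ q := by linarith
  rcases K.eq_empty_or_nonempty with rfl | hne
  · simp
  obtain ⟨k₁, hk₁, hmax⟩ := K.exists_max_image id hne
  obtain ⟨d₁, i₁, hE₁, hadv₁⟩ := hE k₁ hk₁
  have hnear : ∀ k ∈ K, ⌊q ^ k⌋₊ ≤ ⌊q ^ k₁⌋₊ ∧
      (⌊q ^ k₁⌋₊ : ℝ) - ⌊q ^ k⌋₊ ≤ 6 * s * ⌊q ^ k₁⌋₊ := by
    intro k hk
    obtain ⟨d, i, hed, hadv⟩ := hE k hk
    have hle : ⌊q ^ k⌋₊ ≤ ⌊q ^ k₁⌋₊ := Nat.floor_le_floor (pow_le_pow_right₀ hq1 (hmax k hk))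
    exact ⟨hle, sub_le_of_edits (one_le_floor_pow hq1 k) hle (floor_pow_le hq1 (hK k₁ hk₁))
      hed hE₁ hadv hadv₁⟩
  -- For a small top half-period, all others are integers within 6 of it, however many exponents
  -- share a value. Otherwise rounding loses at most a factor `1 - s`, and four steps of `q` already
  -- leave the allowed range.
  rcases le_or_gt (s * ⌊q ^ k₁⌋₊) 1 with hsm | hlg
  · have hsub : (K.image fun k => ⌊q ^ k⌋₊) ⊆ Finset.Icc (⌊q ^ k₁⌋₊ - 6) ⌊q ^ k₁⌋₊ := by
      intro r hr
      obtain ⟨k, hk, rfl⟩ := Finset.mem_image.1 hr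
      obtain ⟨h1, h2⟩ := hnear k hk
      have h3 : (⌊q ^ k₁⌋₊ : ℝ) ≤ ⌊q ^ k⌋₊ + 6 := by linarith
      have h4 : ⌊q ^ k₁⌋₊ ≤ ⌊q ^ k⌋₊ + 6 := by exact_mod_cast h3
      exact Finset.mem_Icc.2 ⟨by omega, h1⟩
    refine (Finset.card_le_card hsub).trans ?_
    rw [Nat.card_Icc]; omega
  · have hsub : K ⊆ Finset.Icc (k₁ - 3) k₁ := by
      intro k hk
      have hkk : k ≤ k₁ := hmax k hk
      refine Finset.mem_Icc.2 ⟨?_, hkk⟩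
      by_contra hlt
      obtain ⟨j, hj⟩ := Nat.exists_eq_add_of_le (show k + 4 ≤ k₁ by omega)
      obtain ⟨-, h2⟩ := hnear k hk
      have hpos : 0 < q ^ k := by positivity
      have hpos₁ : 0 < q ^ k₁ := by positivity
      have h3 : (⌊q ^ k⌋₊ : ℝ) ≤ q ^ k := Nat.floor_le hpos.le
      have h4 := Nat.lt_floor_add_one (q ^ k₁)
      have h4' : (⌊q ^ k₁⌋₊ : ℝ) ≤ q ^ k₁ := Nat.floor_le hpos₁.le
      have h5 : (1 + 16 * s) * q ^ k ≤ q ^ k₁ := by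
        have h6 : 1 + 16 * s ≤ q ^ 4 := by
          have := one_add_mul_le_pow (a := q - 1) (by linarith) 4
          norm_num at this; linarith
        calc (1 + 16 * s) * q ^ k ≤ q ^ 4 * q ^ k := by gcongr
          _ = q ^ (k + 4) := by ring
          _ ≤ q ^ k₁ := pow_le_pow_right₀ hq1 (by omega)
      have h7 : 1 < s * q ^ k₁ := hlg.trans_le (by gcongr)
      have h8 : (1 - s) * q ^ k₁ ≤ ⌊q ^ k₁⌋₊ := by linarith
      have h9 : (1 - 6 * s) * ((1 - s) * q ^ k₁) ≤ q ^ k :=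
        (mul_le_mul_of_nonneg_left h8 (by linarith)).trans (by linarith)
      have h10 : (1 + 16 * s) * ((1 - 6 * s) * ((1 - s) * q ^ k₁)) ≤ 1 * q ^ k₁ := by
        rw [one_mul]
        exact (mul_le_mul_of_nonneg_left h9 (by linarith)).trans h5
      have h11 : (1 + 16 * s) * ((1 - 6 * s) * (1 - s)) ≤ 1 :=
        le_of_mul_le_mul_right (by linarith) hpos₁
      nlinarith [mul_pos hs0 hs0, mul_pos hs0 (mul_pos hs0 hs0)]
    refine Finset.card_image_le.trans ((Finset.card_le_card hsub).trans ?_)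
    rw [Nat.card_Icc]; omega

theorem mainTheorem6 :
    ∃ A : ℝ, 0 < A ∧ ∀ ε : ℝ, 0 < ε → ∃ n₀ : ℕ, ∀ n : ℕ, n₀ ≤ n →
      ∀ δ γ : ℝ, 0 ≤ δ → 0 ≤ γ → γ + 2 * δ < 1 - ε →
        IsListDecodable (bukhMaCode n ε) (δ * n) (γ * n) ⌊A / ε ^ 3⌋₊ := by
  classical
  refine ⟨200000000, by norm_num, fun ε hε => ⟨1, fun n hn δ γ hδ hγ hδγ v => ?_⟩⟩
  have hε1 : ε < 1 := by linarith
  have hn0 : (0 : ℝ) < n := by exact_mod_cast hn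
  obtain ⟨q, hq⟩ : ∃ q, q = 1 / ε ^ 4 := ⟨_, rfl⟩
  have hq1 : 1 < q := by
    rw [hq, one_lt_div (by positivity)]
    exact pow_lt_one₀ hε.le hε1 (by norm_num)
  set K := (Finset.range ⌈Real.logb q n⌉₊).filter fun k => ∃ d i : ℕ,
    Edits d i (bukhMaWord n ⌊q ^ k⌋₊) v ∧ 2 * (d : ℝ) + i < (1 - ε) * n with hKdef
  have hK : ∀ k ∈ K, q ^ k < n := by
    intro k hk
    have h := Nat.lt_ceil.1 (Finset.mem_range.1 (Finset.mem_filter.1 hk).1)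
    rwa [Real.lt_logb_iff_rpow_lt hq1 hn0, Real.rpow_natCast] at h
  have hE := fun k (hk : k ∈ K) => (Finset.mem_filter.1 hk).2
  -- Half-periods are counted instead of exponents, since rounding can merge several exponents into
  -- one codeword.
  have hcard : ((K.image fun k => ⌊q ^ k⌋₊).card : ℝ) ≤ 200000000 / ε ^ 3 := by
    have hε3 : (0 : ℝ) < ε ^ 3 := by positivity
    rcases le_total ε (13 / 14) with h | h
    · refine (card_image_le_of_le hε h hq hn K hK hE).trans ?_
      exact div_le_div_of_nonneg_left (by norm_num) hε3
        (pow_le_pow_of_le_one hε.le hε1.le (by norm_num))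
    · have h7 : ((K.image fun k => ⌊q ^ k⌋₊).card : ℝ) ≤ 7 := by
        exact_mod_cast card_image_le_of_ge h hε1 hq K hK hE
      refine h7.trans ((le_div_iff₀ hε3).2 ?_)
      have := pow_le_one₀ (n := 3) hε.le hε1.le
      linarith
  have hsub : {c ∈ bukhMaCode n ε | ∃ d i : ℕ, (d : ℝ) ≤ δ * n ∧ (i : ℝ) ≤ γ * n ∧ Edits d i c v} ⊆
      (((K.image fun k => ⌊q ^ k⌋₊).image (bukhMaWord n) : Finset (List Bool)) :
        Set (List Bool)) := by
    rintro c ⟨⟨k, hk, rfl⟩, d, i, hd, hi, hed⟩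
    rw [← hq] at hk hed ⊢
    refine Finset.mem_coe.2 (Finset.mem_image_of_mem _ (Finset.mem_image.2 ⟨k, ?_, rfl⟩))
    refine Finset.mem_filter.2 ⟨Finset.mem_range.2 (Nat.lt_ceil.2 hk), d, i, hed, ?_⟩
    have : (γ + 2 * δ) * n < (1 - ε) * n := by gcongr
    linarith
  refine (Set.encard_le_encard hsub).trans ?_
  rw [Set.encard_coe_eq_coe_finsetCard]
  exact_mod_cast Finset.card_image_le.trans (Nat.le_floor hcard)
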